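/- Let $n\ge 1$, let $\mathbb{B}_n$ be the open unit ball of $\mathbb{C}^n$ for the hermitian norm, and let $S_1,\dots,S_n$ be the left creation operators $S_j(e_{i_1}\otimes\cdots\otimes e_{i_m})=e_j\otimes e_{i_1}\otimes\cdots\otimes e_{i_m}$, $S_j(1)=e_j$, on the full Fock space $\mathbb{C}\oplus\mathbb{C}^n\oplus(\mathbb{C}^n)^{\otimes 2}\oplus\cdots$. Let $F_n^\infty$ be the closure, in the weak operator topology, of the unital algebra generated by $S_1,\dots,S_n$, with its weak* topology as a dual space. For $z\in\mathbb{B}_n$ let $\varphi\mapsto\varphi(z)$ denote the unique weak* continuous unital algebra homomorphism $F_n^\infty\to\mathbb{C}$ with $S_j\mapsto z_j$ for $j=1,\dots,n$. For $\Delta\subseteq\mathbb{B}_n$ put $\mathcal{N}_\Delta=\{\varphi\in F_n^\infty:\varphi(z)=0\text{ for all }z\in\Delta\}$. Give $F_n^\infty/\mathcal{N}_\Delta$ the weak* topology it carries as the dual of the polar of $\mathcal{N}_\Delta$ in the predual of $F_n^\infty$. Let the spectrum $\Sigma(F_n^\infty/\mathcal{N}_\Delta)$ be the set of all weak* continuous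 unital algebra homomorphisms $\pi:F_n^\infty/\mathcal{N}_\Delta\to\mathbb{C}$, with the topology of pointwise convergence. The spectral closure $\overline{\Delta}^{\Sigma}$ of $\Delta$ is this spectrum viewed in $\mathbb{C}^n$, that is, the set of the points $(\pi(S_1+\mathcal{N}_\Delta),\dots,\pi(S_n+\mathcal{N}_\Delta))$ with $\pi\in\Sigma(F_n^\infty/\mathcal{N}_\Delta)$. Let $\Delta=\{\lambda_j : j\in I\}\subseteq\mathbb{B}_n$ be a finite or infinite family such that $$\sum_{j\in I}\left(1-\|\lambda_j\|_{\mathbb{C}^n}\right)<\infty .$$ Then the spectrum of $F_n^\infty/\mathcal{N}_\Delta$ is $\Delta$: for each $z\in\Delta$ the map $\varphi+\mathcal{N}_\Delta\mapsto\varphi(z)$ is a well-defined element of $\Sigma(F_n^\infty/\mathcal{N}_\Delta)$, and sending $z$ to this element is a homeomorphism of $\Delta$ onto $\Sigma(F_n^\infty/\mathcal{N}_\Delta)$. Equivalently, $\overline{\Delta}^{\Sigma}=\Delta$. -/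

import Mathlib

noncomputable section

namespace NCHardy

/-- `ℂⁿ` with its hermitian norm. -/
abbrev Cn (n : ℕ) : Type := EuclideanSpace ℂ (Fin n)

/-- The open unit ball `𝔹ₙ` of `ℂⁿ`. -/
abbrev Ball (n : ℕ) : Type := Metric.ball (0 : Cn n) 1

/-- The full Fock space over `ℂⁿ`, in its canonical orthonormal basis: the word
`[i₁, …, iₘ]` stands for `e_{i₁} ⊗ ⋯ ⊗ e_{iₘ}` and the empty word for `1 ∈ ℂ`. -/
abbrev Fock (n : ℕ) : Type := lp (fun _ : List (Fin n) => ℂ) 2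

/-- The basis vector `e_{i₁} ⊗ ⋯ ⊗ e_{iₘ}` of the word `w = [i₁, …, iₘ]`. -/
def basisVec {n : ℕ} (w : List (Fin n)) : Fock n := lp.single 2 w 1

lemma orthonormal_basisVec (n : ℕ) : Orthonormal ℂ (basisVec (n := n)) := by
  classical
  rw [orthonormal_iff_ite]
  intro v w
  rw [basisVec, lp.inner_single_left, basisVec, lp.coeFn_single]
  by_cases h : v = w
  · subst h; simp
  · simp [h]

lemma orthogonalFamily_shift {n : ℕ} (j : Fin n) :
    OrthogonalFamily ℂ (fun _ : List (Fin n) => ℂ)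
      (fun w => LinearIsometry.toSpanSingleton ℂ (Fock n)
        ((orthonormal_basisVec n).1 (j :: w))) :=
  ((orthonormal_basisVec n).comp (List.cons j) List.cons_injective).orthogonalFamily

/-- The left creation operator `S_j`: the bounded operator that sends the basis vector of the
word `w` to that of the word `j :: w`. -/
def creation {n : ℕ} (j : Fin n) : Fock n →L[ℂ] Fock n :=
  (orthogonalFamily_shift j).linearIsometry.toContinuousLinearMap

lemma creation_basisVec {n : ℕ} (j : Fin n) (w : List (Fin n)) :
    creation j (basisVec w) = basisVec (j :: w) := by
  change (orthogonalFamily_shift j).linearIsometry (lp.single 2 w 1) = _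
  rw [OrthogonalFamily.linearIsometry_apply_single]
  simp

/-- The noncommutative Hardy algebra `Fₙ^∞`: the closure, in the weak operator topology, of the
unital algebra generated by the left creation operators. -/
def hardy (n : ℕ) : Subalgebra ℂ (Fock n →L[ℂ] Fock n) :=
  (Algebra.adjoin ℂ (Set.range fun j : Fin n =>
      (ContinuousLinearMapWOT.ofCLM (creation j) : Fock n →WOT[ℂ] Fock n))).topologicalClosure.comap
    (ContinuousLinearMapWOT.algEquiv ℂ).symm.toAlgHom

lemma creation_mem {n : ℕ} (j : Fin n) : creation j ∈ hardy n :=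
  Subalgebra.le_topologicalClosure _ (Algebra.subset_adjoin ⟨j, rfl⟩)

/-- The generator `S_j` as an element of `Fₙ^∞`. -/
def gen {n : ℕ} (j : Fin n) : hardy n := ⟨creation j, creation_mem j⟩

/-- The monomial `z^w = z_{i₁} ⋯ z_{iₘ}` for the word `w = [i₁, …, iₘ]`. -/
def monomial {n : ℕ} (z : Cn n) (w : List (Fin n)) : ℂ := (w.map fun j => z j).prod

lemma memLp_monomial {n : ℕ} (z : Ball n) :
    Memℓp (fun w : List (Fin n) => star (monomial z.1 w)) 2 := by
  have hz : ∑ j, ‖z.1 j‖ ^ 2 < 1 := by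
    have h := z.2
    rw [mem_ball_zero_iff, EuclideanSpace.norm_eq, Real.sqrt_lt' one_pos] at h
    simpa using h
  refine memℓp_gen ?_
  suffices h : Summable fun w : List (Fin n) => (w.map fun j => ‖z.1 j‖ ^ 2).prod by
    refine h.congr fun w => ?_
    simp only [monomial, norm_star, ENNReal.toReal_ofNat, Real.rpow_ofNat]
    induction w with
    | nil => simp
    | cons a w ih => simp [mul_pow, ih]
  rw [← List.equivSigmaTuple.symm.summable_iff]
  have key : ∀ k : ℕ, ∀ f : Fin k → Fin n,
      ((List.ofFn f).map fun j => ‖z.1 j‖ ^ 2).prod = ∏ i, ‖z.1 (f i)‖ ^ 2 := by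
    intro k f
    rw [List.map_ofFn, List.prod_ofFn]
    rfl
  refine (summable_sigma_of_nonneg fun p => ?_).2 ⟨fun k => Summable.of_finite, ?_⟩
  · exact List.prod_nonneg (by simp only [List.mem_map]; rintro _ ⟨j, -, rfl⟩; positivity)
  · refine (summable_geometric_of_lt_one (by positivity) hz).congr fun k => ?_
    rw [tsum_fintype, Fintype.sum_pow]
    exact Finset.sum_congr rfl fun f _ => (key k f).symm

/-- The vector `∑_w conj(z^w) e_w` of the Fock space, for `z ∈ 𝔹ₙ`. -/
def kernelVec {n : ℕ} (z : Ball n) : Fock n :=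
  ⟨fun w => star (monomial z.1 w), memLp_monomial z⟩

lemma inner_kernelVec_basisVec {n : ℕ} (z : Ball n) (w : List (Fin n)) :
    inner ℂ (kernelVec z) (basisVec w) = monomial z.1 w := by
  rw [basisVec, lp.inner_single_right]
  simp [kernelVec]

lemma ext_basisVec {n : ℕ} {f g : Fock n →L[ℂ] ℂ}
    (h : ∀ w, f (basisVec w) = g (basisVec w)) : f = g := by
  ext x
  have hx := lp.hasSum_single (p := 2) (by simp) x
  have h1 : ∀ w, lp.single 2 w (x w) = x w • basisVec w := by
    intro w
    rw [basisVec, ← lp.single_smul]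
    simp
  simp only [h1] at hx
  refine (hx.mapL f).unique ?_
  simpa [h] using hx.mapL g

lemma inner_kernelVec_creation {n : ℕ} (z : Ball n) (j : Fin n) (x : Fock n) :
    inner ℂ (kernelVec z) (creation j x) = z.1 j * inner ℂ (kernelVec z) x := by
  have : (innerSL ℂ (kernelVec z)).comp (creation j) = z.1 j • innerSL ℂ (kernelVec z) := by
    refine ext_basisVec fun w => ?_
    simp [creation_basisVec, inner_kernelVec_basisVec, monomial]
  simpa using DFunLike.congr_fun this x

lemma inner_kernelVec_apply {n : ℕ} (z : Ball n) (φ : hardy n) (x : Fock n) :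
    inner ℂ (kernelVec z) (φ.1 x) =
      inner ℂ (kernelVec z) (φ.1 (basisVec [])) * inner ℂ (kernelVec z) x := by
  let P : Set (Fock n →WOT[ℂ] Fock n) := {T | ∀ x, inner ℂ (kernelVec z) (T x) =
      inner ℂ (kernelVec z) (T (basisVec [])) * inner ℂ (kernelVec z) x}
  have hcl : IsClosed P := by
    simp only [P, Set.ofPred_forall]
    refine isClosed_iInter fun x => isClosed_eq ?_ ?_
    · exact ContinuousLinearMapWOT.continuous_iff.1 continuous_id x _
    · exact (ContinuousLinearMapWOT.continuous_iff.1 continuous_id _ _).mul continuous_const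
  have h0 : inner ℂ (kernelVec z) (basisVec ([] : List (Fin n))) = 1 := by
    rw [inner_kernelVec_basisVec]; simp [monomial]
  have hsub : ∀ T ∈ Algebra.adjoin ℂ (Set.range fun j : Fin n =>
      (ContinuousLinearMapWOT.ofCLM (creation j) : Fock n →WOT[ℂ] Fock n)), T ∈ P := by
    intro T hT
    induction hT using Algebra.adjoin_induction with
    | mem T hT =>
      obtain ⟨j, rfl⟩ := hT
      intro x
      simp [inner_kernelVec_creation, h0]
    | algebraMap c => intro x; simp [h0]
    | add S T _ _ hS hT =>
      intro x
      simp only [ContinuousLinearMapWOT.add_apply, inner_add_right]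
      rw [hS x, hT x, add_mul]
    | mul S T _ _ hS hT =>
      intro x
      simp only [ContinuousLinearMapWOT.mul_apply]
      rw [hS (T x), hT x, hS (T _), mul_assoc]
  exact closure_minimal (fun T hT => hsub T hT) hcl φ.2 x

/-- The point evaluation `φ ↦ φ(z)` at `z ∈ 𝔹ₙ`: the unital homomorphism `π_z : Fₙ^∞ → ℂ`
with `π_z(S_j) = z_j`, that is `φ(z) = ∑_w a_w z^w` where `φ(1) = ∑_w a_w e_w`. -/
def eval {n : ℕ} (z : Ball n) : hardy n →ₐ[ℂ] ℂ where
  toFun φ := inner ℂ (kernelVec z) (φ.1 (basisVec []))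
  map_one' := by simp [inner_kernelVec_basisVec, monomial]
  map_mul' φ ψ := inner_kernelVec_apply z φ (ψ.1 (basisVec []))
  map_zero' := by simp
  map_add' φ ψ := by simp
  commutes' c := by
    simp [Algebra.algebraMap_eq_smul_one, inner_kernelVec_basisVec, monomial]

lemma eval_gen {n : ℕ} (z : Ball n) (j : Fin n) : eval z (gen j) = z.1 j := by
  change inner ℂ (kernelVec z) (creation j (basisVec [])) = _
  simp [creation_basisVec, inner_kernelVec_basisVec, monomial]

/-- The predual of `Fₙ^∞`, as a set of linear functionals: the restrictions of the
normal functionals `T ↦ ∑ₖ ⟨T xₖ, yₖ⟩` with `∑ ‖xₖ‖² < ∞` and `∑ ‖yₖ‖² < ∞` (equivalently, of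
`T ↦ tr(TA)` with `A` of trace class). -/
def predual (n : ℕ) : Set (hardy n →ₗ[ℂ] ℂ) :=
  {f | ∃ x y : ℕ → Fock n, (Summable fun k => ‖x k‖ ^ 2) ∧ (Summable fun k => ‖y k‖ ^ 2) ∧
    ∀ φ : hardy n, f φ = ∑' k, inner ℂ (y k) (φ.1 (x k))}

/-- The weak* topology of `Fₙ^∞ / J`, as the dual of the polar of `J` in the predual of `Fₙ^∞`:
the coarsest topology for which the functionals on `Fₙ^∞ / J` induced by the elements of the
predual that vanish on `J` are continuous. -/
@[reducible] def weakStar {n : ℕ} (J : Ideal (hardy n)) [J.IsTwoSided] : TopologicalSpace (hardy n ⧸ J) :=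
  ⨅ g ∈ {g : (hardy n ⧸ J) →ₗ[ℂ] ℂ | g ∘ₗ (Ideal.Quotient.mkₐ ℂ J).toLinearMap ∈ predual n},
    TopologicalSpace.induced g inferInstance

/-- The spectrum `Σ(Fₙ^∞ / J)`: the weak* continuous unital algebra homomorphisms to `ℂ`. -/
def Spec {n : ℕ} (J : Ideal (hardy n)) [J.IsTwoSided] : Type :=
  {π : (hardy n ⧸ J) →ₐ[ℂ] ℂ // @Continuous _ _ (weakStar J) inferInstance π}

/-- The spectrum carries the weak* topology of the dual of `Fₙ^∞ / J`, which is the topology of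
pointwise convergence. -/
instance instTopSpec {n : ℕ} (J : Ideal (hardy n)) [J.IsTwoSided] : TopologicalSpace (Spec J) :=
  TopologicalSpace.induced (fun π (a : hardy n ⧸ J) => π.1 a) inferInstance

/-- The Nevanlinna ideal `𝒩_Δ = {φ ∈ Fₙ^∞ : φ(z) = 0 for all z ∈ Δ}`. -/
def nevanlinna {n : ℕ} (Δ : Set (Ball n)) : Ideal (hardy n) where
  carrier := {φ | ∀ z ∈ Δ, eval z φ = 0}
  zero_mem' := by simp
  add_mem' := by
    intro a b ha hb z hz
    have h : eval z (a + b) = eval z a + eval z b := (eval z).map_add' a b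
    rw [ha z hz, hb z hz, add_zero] at h
    exact h
  smul_mem' := by
    intro c a ha z hz
    have h := map_mul (eval z) c a
    rw [ha z hz, mul_zero] at h
    exact h

instance nevanlinna_isTwoSided {n : ℕ} (Δ : Set (Ball n)) : (nevanlinna Δ).IsTwoSided :=
  ⟨fun {a} b ha z hz => by
    have h := map_mul (eval z) a b
    rw [ha z hz, zero_mul] at h
    exact h⟩

/-- The spectral closure of `Δ`: the spectrum of `Fₙ^∞ / 𝒩_Δ`, each `π` in it being identified
with the point `(π(S₁ + 𝒩_Δ), …, π(Sₙ + 𝒩_Δ))` of `ℂⁿ`. -/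
def spectralClosure {n : ℕ} (Δ : Set (Ball n)) : Set (Cn n) :=
  {z | ∃ π : Spec (nevanlinna Δ), ∀ j, π.1 (Ideal.Quotient.mk _ (gen j)) = z j}

end NCHardy

end

namespace NCHardy

open Filter Topology ComplexConjugate
open scoped InnerProductSpace

variable {n : ℕ}

/-! ### Linear combinations of creation operators -/

/-! A character of the quotient is weak* continuous exactly when its lift `ρ` to `hardy n` lies in
`predual n`, so the question is which such `ρ` kill the Nevanlinna ideal.

The point `z = (ρ(S_j))` lies in the open ball. Otherwise some row `∑ c_j S_j` with `‖c‖ ≤ 1`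
satisfies `|ρ(row c)| ≥ 1`, whereas its powers push every vector to longer and longer words and so
tend weakly to 0 under bounded norms (`tendsto_row_pow_of_mem_predual`).

Then `ρ` is evaluation at `z`. Every `φ` decomposes as `φ(0) + ∑ S_j φ_j` with `φ_j = S_j^*(φ -
φ(0))` again in the algebra. Hence `ρ - eval z` takes the same value at `φ` and at `∑ z_j φ_j`. The
`m`-th iterate of this replacement has norm at most `(m + 1) ‖z‖ ^ m ‖φ‖`, so the difference
vanishes (`eq_eval_of_bounded`).

Finally `z` belongs to `Δ`. For `z` outside `Δ`, products of Möbius transforms of rows, each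
vanishing at one point of the family, are contractions. The Blaschke condition keeps their values at
`z` away from 0, and a weak operator limit lies in the ideal without vanishing at `z`
(`exists_mem_nevanlinna_eval_ne_zero`).

For the topologies, summability leaves finitely many indices in each smaller ball, so `Δ` is
discrete; the inverse map reads coordinates off the generators. -/

lemma hasSum_basisVec (x : Fock n) : HasSum (fun w => x w • basisVec w) x := by
  have hx := lp.hasSum_single (p := 2) (by simp) x
  refine hx.congr_fun fun w => ?_
  rw [basisVec, ← lp.single_smul]
  simp

lemma inner_creation_creation (i j : Fin n) (x y : Fock n) :
    ⟪creation i x, creation j y⟫_ℂ = if i = j then ⟪x, y⟫_ℂ else 0 := by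
  split_ifs with hij
  · subst hij
    exact (orthogonalFamily_shift i).linearIsometry.inner_map_map x y
  · have h1 : ∀ v, ⟪creation i (basisVec v), creation j y⟫_ℂ = 0 := by
      intro v
      have : (innerSL ℂ (creation i (basisVec v))).comp (creation j) = 0 := by
        refine ext_basisVec fun w => ?_
        have h := orthonormal_iff_ite.1 (orthonormal_basisVec n) (i :: v) (j :: w)
        simpa [creation_basisVec, hij] using h
      exact DFunLike.congr_fun this y
    have : (innerSL ℂ (creation j y)).comp (creation i) = 0 := by
      refine ext_basisVec fun v => ?_
      exact inner_eq_zero_symm.1 (h1 v)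
    exact inner_eq_zero_symm.1 (DFunLike.congr_fun this x)

/-- The operator `∑ j, c j • S_j` as an element of the Hardy algebra. -/
noncomputable def row (c : Cn n) : hardy n := ∑ j, c j • gen j

lemma row_coe_apply (c : Cn n) (x : Fock n) : (row c).1 x = ∑ j, c j • creation j x := by
  simp [row, gen]

/-- The creation operators are isometries with mutually orthogonal ranges, so `row c` is `‖c‖` times
an isometry. -/
lemma norm_row_apply (c : Cn n) (x : Fock n) : ‖(row c).1 x‖ = ‖c‖ * ‖x‖ := by
  have h : ⟪(row c).1 x, (row c).1 x⟫_ℂ = ((‖c‖ * ‖x‖) ^ 2 : ℝ) := by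
    rw [row_coe_apply]
    simp only [sum_inner, inner_sum, inner_smul_left, inner_smul_right, inner_creation_creation]
    have hc : ((‖c‖ ^ 2 : ℝ) : ℂ) = ∑ j, conj (c j) * c j := by
      rw [EuclideanSpace.norm_sq_eq]
      push_cast
      exact Finset.sum_congr rfl fun j _ => (Complex.conj_mul' _).symm
    rw [mul_pow, Complex.ofReal_mul, hc, Finset.sum_mul]
    refine Finset.sum_congr rfl fun i _ => ?_
    rw [Finset.sum_eq_single i (by intros; simp_all) (by simp)]
    rw [if_pos rfl, inner_self_eq_norm_sq_to_K]
    push_cast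
    simp only [Complex.coe_algebraMap]
    ring
  rw [inner_self_eq_norm_sq_to_K] at h
  have h' : ‖(row c).1 x‖ ^ 2 = (‖c‖ * ‖x‖) ^ 2 := Complex.ofReal_injective (by simpa using h)
  exact (sq_eq_sq₀ (norm_nonneg _) (by positivity)).1 h'

lemma norm_row_le (c : Cn n) : ‖row c‖ ≤ ‖c‖ :=
  ContinuousLinearMap.opNorm_le_bound _ (norm_nonneg _) fun x => (norm_row_apply c x).le

lemma map_row (ρ : hardy n →ₐ[ℂ] ℂ) (c : Cn n) : ρ (row c) = ∑ j, c j * ρ (gen j) := by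
  rw [row, map_sum]
  exact Finset.sum_congr rfl fun j _ => ρ.toLinearMap.map_smul _ _

/-- Each factor `row c` lengthens words by one letter. -/
lemma inner_basisVec_row_pow (c : Cn n) (x : Fock n) (w : List (Fin n)) (m : ℕ)
    (hm : w.length < m) : ⟪basisVec w, ((row c) ^ m).1 x⟫_ℂ = 0 := by
  induction w generalizing m with
  | nil =>
    obtain ⟨m, rfl⟩ : ∃ k, m = k + 1 := ⟨m - 1, by omega⟩
    rw [pow_succ']
    change ⟪basisVec [], (row c).1 (((row c) ^ m).1 x)⟫_ℂ = 0
    generalize ((row c) ^ m).1 x = y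
    rw [row_coe_apply, inner_sum]
    refine Finset.sum_eq_zero fun j _ => ?_
    have : (innerSL ℂ (basisVec ([] : List (Fin n)))).comp (creation j) = 0 := by
      refine ext_basisVec fun w => ?_
      have h := orthonormal_iff_ite.1 (orthonormal_basisVec n) [] (j :: w)
      simpa [creation_basisVec] using h
    have h : ⟪basisVec [], creation j y⟫_ℂ = 0 := DFunLike.congr_fun this y
    rw [inner_smul_right, h, mul_zero]
  | cons i w ih =>
    obtain ⟨m, rfl⟩ : ∃ k, m = k + 1 := ⟨m - 1, by omega⟩
    rw [pow_succ']
    change ⟪basisVec (i :: w), (row c).1 (((row c) ^ m).1 x)⟫_ℂ = 0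
    have := ih m (by simpa using hm)
    rw [row_coe_apply, inner_sum]
    refine Finset.sum_eq_zero fun j _ => ?_
    rw [inner_smul_right, ← creation_basisVec, inner_creation_creation]
    rw [this, ite_self, mul_zero]

lemma norm_row_pow_apply_le {c : Cn n} (hc : ‖c‖ ≤ 1) (m : ℕ) (x : Fock n) :
    ‖((row c) ^ m).1 x‖ ≤ ‖x‖ := by
  induction m with
  | zero => simp
  | succ m ih =>
    rw [pow_succ']
    change ‖(row c).1 (((row c) ^ m).1 x)‖ ≤ _
    rw [norm_row_apply]
    exact (mul_le_of_le_one_left (norm_nonneg _) hc).trans ih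

lemma tendsto_inner_row_pow {c : Cn n} (hc : ‖c‖ ≤ 1) (x y : Fock n) :
    Tendsto (fun m => ⟪y, ((row c) ^ m).1 x⟫_ℂ) atTop (𝓝 0) := by
  rw [Metric.tendsto_atTop]
  intro ε hε
  -- The added 1 keeps the divisor positive when `x = 0`.
  have hpos : 0 < ‖x‖ + 1 := by positivity
  obtain ⟨s, hs⟩ := ((Metric.tendsto_nhds.1 (hasSum_basisVec y)) (ε / (‖x‖ + 1))
    (by positivity)).exists
  -- Beyond the longest word of `s`, the truncation `y'` of `y` is orthogonal to the range of the
  -- power.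
  refine ⟨s.sup List.length + 1, fun m hm => ?_⟩
  set y' := ∑ w ∈ s, y w • basisVec w with hy'
  have h0 : ⟪y', ((row c) ^ m).1 x⟫_ℂ = 0 := by
    rw [hy', sum_inner]
    refine Finset.sum_eq_zero fun w hw => ?_
    rw [inner_smul_left, inner_basisVec_row_pow, mul_zero]
    have := Finset.le_sup (f := List.length) hw
    omega
  rw [dist_zero_right]
  have h1 : ⟪y, ((row c) ^ m).1 x⟫_ℂ = ⟪y - y', ((row c) ^ m).1 x⟫_ℂ := by
    rw [inner_sub_left, h0, sub_zero]
  rw [h1]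
  rw [dist_comm, dist_eq_norm] at hs
  calc _ ≤ ‖y - y'‖ * ‖((row c) ^ m).1 x‖ := norm_inner_le_norm _ _
    _ ≤ ‖y - y'‖ * (‖x‖ + 1) := by
      gcongr
      linarith [norm_row_pow_apply_le hc m x]
    _ < ε := (lt_div_iff₀ hpos).1 hs

/-! ### Functionals in the predual -/

lemma summable_inner_predual {x y : ℕ → Fock n} (hx : Summable fun k => ‖x k‖ ^ 2)
    (hy : Summable fun k => ‖y k‖ ^ 2) : Summable fun k => ‖y k‖ * ‖x k‖ := by
  refine Summable.of_nonneg_of_le (fun k => by positivity) (fun k => ?_) (hx.add hy)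
  nlinarith [sq_nonneg (‖x k‖ - ‖y k‖), sq_nonneg (‖x k‖), sq_nonneg ‖y k‖]

lemma norm_inner_apply_le (φ : hardy n) (x y : Fock n) :
    ‖⟪y, φ.1 x⟫_ℂ‖ ≤ ‖y‖ * ‖x‖ * ‖φ‖ := by
  calc _ ≤ ‖y‖ * ‖φ.1 x‖ := norm_inner_le_norm _ _
    _ ≤ ‖y‖ * (‖φ.1‖ * ‖x‖) := by gcongr; exact φ.1.le_opNorm x
    _ = _ := by rw [show ‖φ.1‖ = ‖φ‖ from rfl]; ring

lemma exists_bound_of_mem_predual {f : hardy n →ₗ[ℂ] ℂ} (hf : f ∈ predual n) :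
    ∃ C : ℝ, ∀ φ, ‖f φ‖ ≤ C * ‖φ‖ := by
  obtain ⟨x, y, hx, hy, hf⟩ := hf
  have hs := summable_inner_predual hx hy
  refine ⟨∑' k, ‖y k‖ * ‖x k‖, fun φ => ?_⟩
  rw [hf]
  exact tsum_of_norm_bounded (hs.hasSum.mul_right _) fun k => norm_inner_apply_le φ _ _

lemma tendsto_row_pow_of_mem_predual {f : hardy n →ₗ[ℂ] ℂ} (hf : f ∈ predual n) {c : Cn n}
    (hc : ‖c‖ ≤ 1) : Tendsto (fun m => f ((row c) ^ m)) atTop (𝓝 0) := by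
  obtain ⟨x, y, hx, hy, hf⟩ := hf
  have hs := summable_inner_predual hx hy
  have := tendsto_tsum_of_dominated_convergence (𝓕 := atTop)
    (f := fun m k => ⟪y k, ((row c) ^ m).1 (x k)⟫_ℂ) (g := fun _ => 0) hs
    (fun k => tendsto_inner_row_pow hc (x k) (y k))
    (Eventually.of_forall fun m k => (norm_inner_le_norm _ _).trans (by
      gcongr; exact norm_row_pow_apply_le hc m _))
  simpa [hf] using this

lemma add_mem_predual {f g : hardy n →ₗ[ℂ] ℂ} (hf : f ∈ predual n) (hg : g ∈ predual n) :
    f + g ∈ predual n := by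
  obtain ⟨x, y, hx, hy, hf⟩ := hf
  obtain ⟨x', y', hx', hy', hg⟩ := hg
  -- The two series are interleaved into one sequence.
  obtain ⟨e⟩ : Nonempty (ℕ ⊕ ℕ ≃ ℕ) := ⟨Equiv.natSumNatEquivNat⟩
  refine ⟨Sum.elim x x' ∘ e.symm, Sum.elim y y' ∘ e.symm, ?_, ?_, fun φ => ?_⟩
  · rw [← e.summable_iff]
    exact Summable.sum _ (by simpa [Function.comp_def] using hx)
      (by simpa [Function.comp_def] using hx')
  · rw [← e.summable_iff]
    exact Summable.sum _ (by simpa [Function.comp_def] using hy)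
      (by simpa [Function.comp_def] using hy')
  · have h1 : Summable fun k => ⟪y k, φ.1 (x k)⟫_ℂ :=
      Summable.of_norm_bounded ((summable_inner_predual hx hy).mul_right ‖φ‖)
        fun k => norm_inner_apply_le φ _ _
    have h2 : Summable fun k => ⟪y' k, φ.1 (x' k)⟫_ℂ :=
      Summable.of_norm_bounded ((summable_inner_predual hx' hy').mul_right ‖φ‖)
        fun k => norm_inner_apply_le φ _ _
    have h3 : HasSum (fun s : ℕ ⊕ ℕ => ⟪Sum.elim y y' s, φ.1 (Sum.elim x x' s)⟫_ℂ)
        (f φ + g φ) := by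
      rw [hf, hg]
      exact HasSum.sum h1.hasSum h2.hasSum
    rw [← e.tsum_eq]
    simpa using h3.tsum_eq.symm

lemma smul_mem_predual {f : hardy n →ₗ[ℂ] ℂ} (hf : f ∈ predual n) (a : ℂ) :
    a • f ∈ predual n := by
  obtain ⟨x, y, hx, hy, hf⟩ := hf
  refine ⟨fun k => a • x k, y, ?_, hy, fun φ => ?_⟩
  · simpa [norm_smul, mul_pow] using hx.mul_left (‖a‖ ^ 2)
  · simp [hf, tsum_mul_left]

lemma zero_mem_predual : (0 : hardy n →ₗ[ℂ] ℂ) ∈ predual n :=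
  ⟨0, 0, by simp, by simp, by simp⟩

lemma eval_mem_predual (z : Ball n) : (eval z).toLinearMap ∈ predual n := by
  refine ⟨Pi.single 0 (basisVec []), Pi.single 0 (kernelVec z), ?_, ?_, fun φ => ?_⟩
  · exact summable_of_ne_finset_zero (s := {0}) (by intro b hb; simp_all)
  · exact summable_of_ne_finset_zero (s := {0}) (by intro b hb; simp_all)
  · rw [tsum_eq_single 0 (by intro b hb; simp [hb])]
    simp only [Pi.single_eq_same]
    rfl

/-- For the topology induced by a family of linear functionals, the continuous functionals are its
span; the predual is already a linear space. -/
lemma continuous_weakStar_iff (J : Ideal (hardy n)) [J.IsTwoSided]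
    (π : (hardy n ⧸ J) →ₗ[ℂ] ℂ) :
    @Continuous _ _ (weakStar J) inferInstance π ↔
      π ∘ₗ (Ideal.Quotient.mkₐ ℂ J).toLinearMap ∈ predual n := by
  let A := {g : (hardy n ⧸ J) →ₗ[ℂ] ℂ | g ∘ₗ (Ideal.Quotient.mkₐ ℂ J).toLinearMap ∈ predual n}
  have hA : weakStar J = ⨅ g : A, TopologicalSpace.induced g.1 inferInstance :=
    (iInf_subtype' (p := fun g => g ∈ A)
      (f := fun g _ => TopologicalSpace.induced g inferInstance))
  rw [hA, ← LinearMap.mem_span_iff_continuous (f := fun g : A => g.1), Subtype.range_coe]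
  refine ⟨fun h => ?_, fun h => Submodule.subset_span h⟩
  induction h using Submodule.span_induction with
  | mem g hg => exact hg
  | zero => exact zero_mem_predual
  | add f g _ _ hf hg => exact add_mem_predual hf hg
  | smul a f _ hf => exact smul_mem_predual hf a

/-! ### The backward shift and characters over points of the ball -/

/-- The vacuum vector `1` of the Fock space. -/
noncomputable abbrev vacuum (n : ℕ) : Fock n := basisVec []

/-- The centre of the ball. -/
def origin (n : ℕ) : Ball n := ⟨0, by simp⟩

lemma kernelVec_origin : kernelVec (origin n) = vacuum n := by
  classical
  refine lp.ext (funext fun w => ?_)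
  rw [vacuum, basisVec, lp.coeFn_single]
  cases w with
  | nil => simp [kernelVec, monomial]
  | cons i w => simp [kernelVec, monomial, origin]

lemma norm_vacuum : ‖vacuum n‖ = 1 := (orthonormal_basisVec n).1 []

lemma eval_origin (φ : hardy n) : eval (origin n) φ = ⟪vacuum n, φ.1 (vacuum n)⟫_ℂ := by
  rw [← kernelVec_origin]
  change ⟪kernelVec (origin n), φ.1 (basisVec [])⟫_ℂ = _
  rw [kernelVec_origin]

/-- The vacuum is the kernel vector of the origin, hence an eigenvector of every `φ^*`. -/
lemma inner_vacuum_apply (φ : hardy n) (x : Fock n) :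
    ⟪vacuum n, φ.1 x⟫_ℂ = eval (origin n) φ * ⟪vacuum n, x⟫_ℂ := by
  have := inner_kernelVec_apply (origin n) φ x
  rwa [kernelVec_origin, ← eval_origin] at this

lemma norm_eval_origin_le (φ : hardy n) : ‖eval (origin n) φ‖ ≤ ‖φ.1 (vacuum n)‖ := by
  rw [eval_origin]
  simpa [norm_vacuum] using norm_inner_le_norm (𝕜 := ℂ) (vacuum n) (φ.1 (vacuum n))

lemma ext_basisVec_operator {S T : Fock n →L[ℂ] Fock n}
    (h : ∀ w, S (basisVec w) = T (basisVec w)) : S = T := by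
  ext1 x
  refine ext_inner_left ℂ fun y => ?_
  have : (innerSL ℂ y).comp S = (innerSL ℂ y).comp T := ext_basisVec fun w => by simp [h w]
  exact DFunLike.congr_fun this x

lemma adjoint_creation_creation (i j : Fin n) (x : Fock n) :
    (creation j).adjoint (creation i x) = if j = i then x else 0 := by
  refine ext_inner_left ℂ fun y => ?_
  rw [ContinuousLinearMap.adjoint_inner_right, inner_creation_creation]
  split_ifs <;> simp

lemma adjoint_creation_vacuum (j : Fin n) : (creation j).adjoint (vacuum n) = 0 := by
  have : (innerSL ℂ (vacuum n)).comp (creation j) = 0 := by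
    refine ext_basisVec fun w => ?_
    have h := orthonormal_iff_ite.1 (orthonormal_basisVec n) [] (j :: w)
    simpa [creation_basisVec] using h
  refine ext_inner_left ℂ fun y => ?_
  rw [ContinuousLinearMap.adjoint_inner_right, inner_zero_right]
  exact inner_eq_zero_symm.1 (DFunLike.congr_fun this y)

/-- A word is either empty or has a first letter, so the vacuum and the ranges of the `S_j`
decompose the Fock space. -/
lemma sum_creation_adjoint (x : Fock n) :
    ⟪vacuum n, x⟫_ℂ • vacuum n + ∑ j, creation j ((creation j).adjoint x) = x := by
  have : (innerSL ℂ (vacuum n)).smulRight (vacuum n) +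
      ∑ j, (creation j).comp (creation j).adjoint = ContinuousLinearMap.id ℂ (Fock n) := by
    refine ext_basisVec_operator fun w => ?_
    have h := orthonormal_iff_ite.1 (orthonormal_basisVec n) [] w
    cases w with
    | nil => simp [adjoint_creation_vacuum, norm_vacuum]
    | cons i w =>
      rw [← creation_basisVec] at h ⊢
      simp [adjoint_creation_creation, h, apply_ite]
  simpa using DFunLike.congr_fun this x

lemma mem_hardy_of_tendsto {α : Type*} {l : Filter α} [l.NeBot] {φ : α → hardy n}
    {T : Fock n →L[ℂ] Fock n}
    (h : ∀ x y, Tendsto (fun a => ⟪y, (φ a).1 x⟫_ℂ) l (𝓝 ⟪y, T x⟫_ℂ)) : T ∈ hardy n := by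
  have ht : Tendsto (fun a => (ContinuousLinearMapWOT.ofCLM (φ a).1 : Fock n →WOT[ℂ] Fock n)) l
      (𝓝 (ContinuousLinearMapWOT.ofCLM T)) :=
    ContinuousLinearMapWOT.tendsto_iff_forall_inner_apply_tendsto.2 h
  exact (Subalgebra.isClosed_topologicalClosure _).mem_of_tendsto ht
    (Eventually.of_forall fun a => (φ a).2)

/-- The map `G` below is continuous for the weak operator topology, so polynomials suffice. On them
it is controlled by the twisted Leibniz rule `G(ST) = G(S) T + S(0) G(T)` and by its values 0 or 1
on generators. -/
lemma backwardShift_mem (j : Fin n) (φ : hardy n) :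
    (creation j).adjoint * (φ.1 - eval (origin n) φ • 1) ∈ hardy n := by
  let A := Algebra.adjoin ℂ (Set.range fun j : Fin n =>
      (ContinuousLinearMapWOT.ofCLM (creation j) : Fock n →WOT[ℂ] Fock n))
  let G : (Fock n →WOT[ℂ] Fock n) → (Fock n →WOT[ℂ] Fock n) := fun T =>
    ContinuousLinearMapWOT.ofCLM
      ((creation j).adjoint * (T.toCLM - ⟪vacuum n, T (vacuum n)⟫_ℂ • 1))
  have hG : Continuous G := by
    refine ContinuousLinearMapWOT.continuous_iff.2 fun x y => ?_
    have : ∀ T, ⟪y, G T x⟫_ℂ = ⟪creation j y, T x⟫_ℂ -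
        ⟪vacuum n, T (vacuum n)⟫_ℂ * ⟪creation j y, x⟫_ℂ := by
      intro T
      simp only [G, ContinuousLinearMapWOT.ofCLM_apply, mul_apply_eq_comp,
        ContinuousLinearMap.adjoint_inner_right]
      simp [inner_sub_right, inner_smul_right]
    simp only [this]
    exact (ContinuousLinearMapWOT.continuous_iff.1 continuous_id _ _).sub
      ((ContinuousLinearMapWOT.continuous_iff.1 continuous_id _ _).mul continuous_const)
  have hA : ∀ T ∈ A, G T ∈ A.topologicalClosure := by
    intro T hT
    induction hT using Algebra.adjoin_induction with
    | mem T hT =>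
      obtain ⟨i, rfl⟩ := hT
      have h0 : ⟪vacuum n, creation i (vacuum n)⟫_ℂ = 0 := by
        rw [← ContinuousLinearMap.adjoint_inner_left, adjoint_creation_vacuum, inner_zero_left]
      have : G (ContinuousLinearMapWOT.ofCLM (creation i)) = if j = i then 1 else 0 := by
        refine ContinuousLinearMapWOT.ext fun x => ?_
        simp only [G, ContinuousLinearMapWOT.ofCLM_apply, h0]
        simp only [zero_smul, sub_zero]
        rw [mul_apply_eq_comp, adjoint_creation_creation]
        split_ifs <;> rfl
      rw [this]
      split_ifs
      exacts [one_mem _, zero_mem _]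
    | algebraMap c =>
      have : G (algebraMap ℂ _ c) = 0 := by
        refine ContinuousLinearMapWOT.ext fun x => ?_
        simp only [G, ContinuousLinearMapWOT.ofCLM_apply, mul_apply_eq_comp]
        simp [norm_vacuum]
      rw [this]
      exact zero_mem _
    | add S T _ _ hS hT =>
      have : G (S + T) = G S + G T := by
        refine ContinuousLinearMapWOT.ext fun x => ?_
        simp only [G, ContinuousLinearMapWOT.ofCLM_apply, mul_apply_eq_comp,
          ContinuousLinearMapWOT.add_apply, ContinuousLinearMapWOT.toCLM_add, ← map_add,
          inner_add_right]
        congr 1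
        change S x + T x - (_ + _ : ℂ) • x = S x - (_ : ℂ) • x + (T x - (_ : ℂ) • x)
        rw [add_smul, add_sub_add_comm]
      rw [this]
      exact add_mem hS hT
    | mul S T hSA hTA hS hT =>
      have h0 : ⟪vacuum n, S (T (vacuum n))⟫_ℂ =
          ⟪vacuum n, S (vacuum n)⟫_ℂ * ⟪vacuum n, T (vacuum n)⟫_ℂ := by
        have := inner_vacuum_apply ⟨S.toCLM, A.le_topologicalClosure hSA⟩ (T (vacuum n))
        rwa [eval_origin] at this
      have : G (S * T) = G S * T + ⟪vacuum n, S (vacuum n)⟫_ℂ • G T := by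
        refine ContinuousLinearMapWOT.ext fun x => ?_
        simp only [G, ContinuousLinearMapWOT.ofCLM_apply, mul_apply_eq_comp,
          ContinuousLinearMapWOT.add_apply, ContinuousLinearMapWOT.mul_apply,
          ContinuousLinearMapWOT.smul_apply, ← map_smul, h0, ← map_add]
        congr 1
        simp [smul_sub, smul_smul]
      rw [this]
      exact add_mem (mul_mem hS (A.le_topologicalClosure hTA)) (Subalgebra.smul_mem _ hT _)
  have : G (ContinuousLinearMapWOT.ofCLM φ.1) ∈ A.topologicalClosure :=
    closure_minimal (t := G ⁻¹' A.topologicalClosure) (fun T hT => hA T hT)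
      ((Subalgebra.isClosed_topologicalClosure _).preimage hG) φ.2
  rw [eval_origin]
  exact this

/-- The backward shift `S_j^* (φ - φ(0))` of `φ`. -/
noncomputable def backwardShift (j : Fin n) (φ : hardy n) : hardy n :=
  ⟨_, backwardShift_mem j φ⟩

lemma eq_eval_origin_add (φ : hardy n) :
    φ = algebraMap ℂ _ (eval (origin n) φ) + ∑ j, gen j * backwardShift j φ := by
  refine Subtype.ext (ContinuousLinearMap.ext fun x => ?_)
  have h := sum_creation_adjoint (φ.1 x - eval (origin n) φ • x)
  -- Subtracting `φ(0)` removes the vacuum component, leaving only the sum over first letters.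
  rw [inner_sub_right, inner_smul_right, inner_vacuum_apply, sub_self, zero_smul, zero_add] at h
  have h2 : (∑ j, gen j * backwardShift j φ).1 x =
      ∑ j, creation j ((creation j).adjoint (φ.1 x - eval (origin n) φ • x)) := by
    rw [AddSubmonoidClass.coe_finsetSum, sum_apply]
    rfl
  change _ = eval (origin n) φ • x + (∑ j, gen j * backwardShift j φ).1 x
  rw [h2, h]
  abel

/-- The operator `L^* (φ - φ(0))` where `L = ∑ j, conj (z j) • S_j`. -/
noncomputable def backwardShiftSum (z : Cn n) (φ : hardy n) : hardy n :=
  ∑ j, z j • backwardShift j φ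

lemma map_eq_eval_origin_add (ρ : hardy n →ₐ[ℂ] ℂ) {z : Cn n} (hz : ∀ j, ρ (gen j) = z j)
    (φ : hardy n) : ρ φ = eval (origin n) φ + ρ (backwardShiftSum z φ) := by
  conv_lhs => rw [eq_eval_origin_add φ]
  rw [show ∀ a b, ρ (a + b) = ρ a + ρ b from ρ.map_add', AlgHom.commutes, map_sum, backwardShiftSum, map_sum]
  refine congrArg _ (Finset.sum_congr rfl fun j _ => ?_)
  rw [map_mul, hz]
  exact (ρ.toLinearMap.map_smul _ _).symm

/-- The operator is the adjoint of the row with conjugate coefficients. -/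
lemma norm_sum_adjoint_creation_le (z : Cn n) (x : Fock n) :
    ‖∑ j, z j • (creation j).adjoint x‖ ≤ ‖z‖ * ‖x‖ := by
  let c : Cn n := WithLp.toLp 2 fun j => conj (z j)
  have hc : ‖c‖ = ‖z‖ := by simp [EuclideanSpace.norm_eq, c]
  have h : ∑ j, z j • (creation j).adjoint x = (row c).1.adjoint x := by
    refine ext_inner_left ℂ fun y => ?_
    rw [ContinuousLinearMap.adjoint_inner_right, row_coe_apply, inner_sum, sum_inner]
    refine Finset.sum_congr rfl fun j _ => ?_
    rw [inner_smul_right, inner_smul_left, ContinuousLinearMap.adjoint_inner_right]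
    simp [c]
  rw [h, ← hc]
  refine (ContinuousLinearMap.le_opNorm _ _).trans ?_
  gcongr
  rw [LinearIsometryEquiv.norm_map]
  exact norm_row_le c

lemma backwardShiftSum_apply (z : Cn n) (φ : hardy n) (x : Fock n) :
    (backwardShiftSum z φ).1 x =
      ∑ j, z j • (creation j).adjoint (φ.1 x - eval (origin n) φ • x) := by
  rw [backwardShiftSum, AddSubmonoidClass.coe_finsetSum, sum_apply]
  rfl

/-- Since `S_j^*` kills the vacuum, the constant term costs nothing here, unlike in the operator
norm. -/
lemma norm_backwardShiftSum_vacuum_le (z : Cn n) (φ : hardy n) :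
    ‖(backwardShiftSum z φ).1 (vacuum n)‖ ≤ ‖z‖ * ‖φ.1 (vacuum n)‖ := by
  rw [backwardShiftSum_apply]
  simp only [map_sub, map_smul, adjoint_creation_vacuum, smul_zero, sub_zero]
  exact norm_sum_adjoint_creation_le z _

lemma norm_backwardShiftSum_le (z : Cn n) (φ : hardy n) :
    ‖backwardShiftSum z φ‖ ≤ ‖z‖ * (‖φ‖ + ‖φ.1 (vacuum n)‖) := by
  refine ContinuousLinearMap.opNorm_le_bound _ (by positivity) fun x => ?_
  change ‖(backwardShiftSum z φ).1 x‖ ≤ _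
  rw [backwardShiftSum_apply, mul_assoc]
  refine (norm_sum_adjoint_creation_le z _).trans ?_
  gcongr
  refine (norm_sub_le _ _).trans ?_
  rw [add_mul, norm_smul]
  gcongr
  · exact φ.1.le_opNorm x
  · exact norm_eval_origin_le φ

/-- Bounding the constant term by the norm at the vacuum, which decays like `‖z‖ ^ m`, makes the
loss a factor `m + 1`. Bounding it by `‖φ‖` would give `(2‖z‖) ^ m`, useless for `‖z‖ ≥ 1/2`. -/
lemma norm_iterate_backwardShiftSum_le (z : Cn n) (φ : hardy n) (m : ℕ) :
    ‖((backwardShiftSum z)^[m] φ).1 (vacuum n)‖ ≤ ‖z‖ ^ m * ‖φ‖ ∧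
      ‖(backwardShiftSum z)^[m] φ‖ ≤ (m + 1) * ‖z‖ ^ m * ‖φ‖ := by
  induction m with
  | zero =>
    refine ⟨?_, by simp⟩
    have h := φ.1.le_opNorm (vacuum n)
    rw [norm_vacuum, mul_one] at h
    rwa [pow_zero, one_mul]
  | succ m ih =>
    rw [Function.iterate_succ_apply']
    constructor
    · refine (norm_backwardShiftSum_vacuum_le z _).trans ?_
      rw [pow_succ', mul_assoc]
      gcongr
      exact ih.1
    · refine (norm_backwardShiftSum_le z _).trans ?_
      calc _ ≤ ‖z‖ * ((m + 1) * ‖z‖ ^ m * ‖φ‖ + ‖z‖ ^ m * ‖φ‖) := by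
            gcongr
            exacts [ih.2, ih.1]
        _ = _ := by push_cast; ring

/-- A bounded character of the Hardy algebra over a point of the open ball is the evaluation
at that point. -/
theorem eq_eval_of_bounded {ρ : hardy n →ₐ[ℂ] ℂ} {C : ℝ} (hC : ∀ φ, ‖ρ φ‖ ≤ C * ‖φ‖)
    (z : Ball n) (hz : ∀ j, ρ (gen j) = z.1 j) : ρ = eval z := by
  obtain ⟨C', hC'⟩ := exists_bound_of_mem_predual (eval_mem_predual z)
  ext φ
  have hm : ∀ m : ℕ, ρ φ - eval z φ = ρ ((backwardShiftSum z.1)^[m] φ) -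
      eval z ((backwardShiftSum z.1)^[m] φ) := by
    intro m
    induction m with
    | zero => rfl
    | succ m ih =>
      rw [ih, Function.iterate_succ_apply']
      generalize (backwardShiftSum z.1)^[m] φ = ψ
      rw [map_eq_eval_origin_add ρ hz, map_eq_eval_origin_add (eval z) (eval_gen z) ψ]
      ring
  have hb : ∀ m : ℕ, ‖ρ φ - eval z φ‖ ≤ (|C| + |C'|) * ‖φ‖ * ((m + 1) * ‖z.1‖ ^ m) := by
    intro m
    rw [hm m]
    have h := (norm_iterate_backwardShiftSum_le z.1 φ m).2
    set ψ := (backwardShiftSum z.1)^[m] φ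
    calc _ ≤ ‖ρ ψ‖ + ‖eval z ψ‖ := norm_sub_le _ _
      _ ≤ C * ‖ψ‖ + C' * ‖ψ‖ := add_le_add (hC ψ) (hC' ψ)
      _ ≤ |C| * ‖ψ‖ + |C'| * ‖ψ‖ := by gcongr <;> exact le_abs_self _
      _ = (|C| + |C'|) * ‖ψ‖ := by ring
      _ ≤ (|C| + |C'|) * ((m + 1) * ‖z.1‖ ^ m * ‖φ‖) := by gcongr
      _ = _ := by ring
  have hz1 : ‖z.1‖ < 1 := mem_ball_zero_iff.1 z.2
  have ht : Tendsto (fun m : ℕ => ((m : ℝ) + 1) * ‖z.1‖ ^ m) atTop (𝓝 0) := by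
    have h1 := tendsto_self_mul_const_pow_of_lt_one (norm_nonneg z.1) hz1
    have h2 := tendsto_pow_atTop_nhds_zero_of_lt_one (norm_nonneg z.1) hz1
    simpa [add_mul] using h1.add h2
  have := ge_of_tendsto' (ht.const_mul ((|C| + |C'|) * ‖φ‖)) hb
  rw [mul_zero] at this
  exact sub_eq_zero.1 (norm_le_zero_iff.1 this)

/-- The generators are sent into the open ball by every weak* continuous character. -/
theorem exists_ball_of_mem_predual {ρ : hardy n →ₐ[ℂ] ℂ} (hρ : ρ.toLinearMap ∈ predual n) :
    ∃ z : Ball n, ∀ j, ρ (gen j) = z.1 j := by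
  let z : Cn n := WithLp.toLp 2 fun j => ρ (gen j)
  suffices h : ‖z‖ < 1 from ⟨⟨z, by simpa using h⟩, fun j => rfl⟩
  by_contra! h
  have hz : 0 < ‖z‖ := by linarith
  -- The normalised conjugate of `z`, for which Cauchy–Schwarz is an equality: `ρ (row c) = ‖z‖`.
  let c : Cn n := WithLp.toLp 2 fun j => conj (z j) / ‖z‖
  have hsum : ∑ j, ‖z j‖ ^ 2 = ‖z‖ ^ 2 := (EuclideanSpace.norm_sq_eq z).symm
  have hc : ‖c‖ ≤ 1 := by
    rw [← sq_le_one_iff₀ (norm_nonneg _), EuclideanSpace.norm_sq_eq]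
    have : ∀ j, ‖c j‖ ^ 2 = ‖z j‖ ^ 2 / ‖z‖ ^ 2 := fun j => by simp [c, div_pow]
    simp only [this]
    rw [← Finset.sum_div, hsum, div_self (by positivity)]
  have hρc : ρ (row c) = ‖z‖ := by
    rw [map_row]
    have : ∀ j, c j * ρ (gen j) = ((‖z j‖ ^ 2 : ℝ) : ℂ) / ‖z‖ := by
      intro j
      have hj : ρ (gen j) = z j := rfl
      simp only [c, hj]
      push_cast
      rw [← Complex.conj_mul']
      ring
    simp only [this]
    rw [← Finset.sum_div, ← Complex.ofReal_sum, hsum]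
    push_cast
    field_simp
  have ht := (tendsto_row_pow_of_mem_predual hρ hc).norm
  simp only [AlgHom.toLinearMap_apply, map_pow, hρc, norm_zero, norm_pow] at ht
  have := ge_of_tendsto' ht (b := 1) fun m => one_le_pow₀ (by simpa using h)
  linarith

theorem exists_eq_eval_of_mem_predual {ρ : hardy n →ₐ[ℂ] ℂ} (hρ : ρ.toLinearMap ∈ predual n) :
    ∃ z : Ball n, ρ = eval z := by
  obtain ⟨z, hz⟩ := exists_ball_of_mem_predual hρ
  obtain ⟨C, hC⟩ := exists_bound_of_mem_predual hρ
  exact ⟨z, eq_eval_of_bounded hC z hz⟩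

/-! ### Contractions vanishing at a point -/

/-- `eval z φ` is the normalised diagonal coefficient of `φ` at `kernelVec z`. -/
lemma norm_eval_le (z : Ball n) (φ : hardy n) : ‖eval z φ‖ ≤ ‖φ‖ := by
  have hk : 0 < ‖kernelVec z‖ := by
    refine norm_pos_iff.2 fun h => ?_
    have := inner_kernelVec_basisVec z []
    simp [h, monomial] at this
  have h : ⟪kernelVec z, φ.1 (kernelVec z)⟫_ℂ = eval z φ * ⟪kernelVec z, kernelVec z⟫_ℂ :=
    inner_kernelVec_apply z φ _
  have h2 := norm_inner_apply_le φ (kernelVec z) (kernelVec z)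
  rw [h, norm_mul, inner_self_eq_norm_sq_to_K] at h2
  simp only [Complex.coe_algebraMap, norm_pow, Complex.norm_real, norm_norm] at h2
  refine le_of_mul_le_mul_right ?_ (pow_pos hk 2)
  linarith

lemma isClosed_hardy : IsClosed (hardy n : Set (Fock n →L[ℂ] Fock n)) := by
  have hc : Continuous fun T : Fock n →L[ℂ] Fock n =>
      (ContinuousLinearMapWOT.ofCLM T : Fock n →WOT[ℂ] Fock n) := by
    refine ContinuousLinearMapWOT.continuous_iff.2 fun x y => ?_
    simp only [ContinuousLinearMapWOT.ofCLM_apply]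
    fun_prop
  exact (Subalgebra.isClosed_topologicalClosure _).preimage hc

instance completeSpace_hardy : CompleteSpace (hardy n) :=
  isClosed_hardy.completeSpace_coe

/-- The cross terms agree because `r` is real, and the squared norms differ by `(1 - r²)(‖x‖² - ‖L
x‖²)`. -/
lemma norm_blaschke_apply_le {L : hardy n} (hL : ‖L‖ ≤ 1) {r : ℝ} (h0 : 0 ≤ r) (h1 : r ≤ 1)
    (x : Fock n) : ‖(r : ℂ) • x - L.1 x‖ ≤ ‖x - (r : ℂ) • L.1 x‖ := by
  have hLx : ‖L.1 x‖ ≤ ‖x‖ := (L.1.le_opNorm x).trans (mul_le_of_le_one_left (norm_nonneg x) hL)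
  refine (sq_le_sq₀ (norm_nonneg _) (norm_nonneg _)).1 ?_
  rw [norm_sub_sq (𝕜 := ℂ), norm_sub_sq (𝕜 := ℂ), inner_smul_left, inner_smul_right, norm_smul,
    norm_smul, Complex.conj_ofReal, Complex.norm_real, Real.norm_of_nonneg h0]
  have h2 : 0 ≤ (1 - r ^ 2) * (‖x‖ ^ 2 - ‖L.1 x‖ ^ 2) := by
    refine mul_nonneg ?_ ?_
    · nlinarith
    · nlinarith [norm_nonneg (L.1 x)]
  nlinarith

/-- The Möbius transform of a contraction `L` in the Hardy algebra. -/
lemma exists_blaschke {L : hardy n} (hL : ‖L‖ ≤ 1) {r : ℝ} (h0 : 0 ≤ r) (h1 : r < 1) :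
    ∃ b : hardy n, ‖b‖ ≤ 1 ∧ b * (1 - (r : ℂ) • L) = algebraMap ℂ _ (r : ℂ) - L := by
  have hlt : ‖(r : ℂ) • L‖ < 1 := by
    have h : ‖(r : ℂ) • L‖ ≤ ‖(r : ℂ)‖ * ‖L‖ := norm_smul_le _ _
    rw [Complex.norm_real, Real.norm_of_nonneg h0] at h
    exact (h.trans (mul_le_of_le_one_right h0 hL)).trans_lt h1
  obtain ⟨u, hu⟩ := isUnit_one_sub_of_norm_lt_one hlt
  refine ⟨(algebraMap ℂ _ (r : ℂ) - L) * (u⁻¹ : (hardy n)ˣ), ?_, ?_⟩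
  -- Substituting `y = (1 - rL) x` reduces contractivity to `norm_blaschke_apply_le`.
  · refine ContinuousLinearMap.opNorm_le_bound _ zero_le_one fun y => ?_
    have hy : ((u : hardy n) * (u⁻¹ : (hardy n)ˣ)).1 y = y := by
      rw [Units.mul_inv]
      rfl
    rw [hu] at hy
    set x := ((u⁻¹ : (hardy n)ˣ) : hardy n).1 y
    have hx := norm_blaschke_apply_le hL h0 h1.le x
    rw [one_mul]
    exact hx.trans_eq (congrArg _ hy)
  · rw [← hu, mul_assoc, Units.inv_mul, mul_one]

lemma one_sub_le_of_blaschke {r d : ℝ} {t β : ℂ} (h0 : 0 ≤ r) (h1 : r < 1) (ht : ‖t‖ ≤ 1 - d)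
    (hd : 0 < d) (hβ : β * (1 - r * t) = r - t) : 1 - 2 / d ^ 2 * (1 - r) ≤ ‖β‖ := by
  have hM : d ≤ ‖1 - r * t‖ := by
    have h := norm_sub_norm_le (1 : ℂ) (r * t)
    rw [norm_one, norm_mul, Complex.norm_real, Real.norm_of_nonneg h0] at h
    nlinarith [norm_nonneg t]
  have hsq : ‖1 - r * t‖ ^ 2 - ‖r - t‖ ^ 2 = (1 - r ^ 2) * (1 - ‖t‖ ^ 2) := by
    simp only [Complex.sq_norm, Complex.normSq_apply]
    simp
    ring
  rw [← hβ, norm_mul] at hsq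
  rcases le_or_gt 1 ‖β‖ with h | h
  · have : 0 ≤ 2 / d ^ 2 * (1 - r) := mul_nonneg (by positivity) (by linarith)
    linarith
  have h3 : (1 - ‖β‖) * d ^ 2 ≤ 2 * (1 - r) := by
    calc (1 - ‖β‖) * d ^ 2 ≤ (1 - ‖β‖ ^ 2) * ‖1 - r * t‖ ^ 2 := by
          gcongr
          · nlinarith [norm_nonneg β]
          · nlinarith [norm_nonneg β]
      _ = (1 - r ^ 2) * (1 - ‖t‖ ^ 2) := by rw [← hsq]; ring
      _ ≤ (1 - r ^ 2) * 1 := by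
          gcongr
          · nlinarith
          · nlinarith [sq_nonneg ‖t‖]
      _ ≤ 2 * (1 - r) := by nlinarith
  have h4 := (le_div_iff₀ (by positivity : 0 < d ^ 2)).2 h3
  have : 2 * (1 - r) / d ^ 2 = 2 / d ^ 2 * (1 - r) := by ring
  linarith

lemma eval_row (z : Ball n) (c : Cn n) : eval z (row c) = ∑ j, c j * z.1 j := by
  simp only [map_row, eval_gen]

/-- Take the Möbius transform, with parameter `‖p‖`, of the row whose value at `w` is `⟪p, w⟫ /
‖p‖`: this value is `‖p‖` at `p` and at most `‖z‖` in modulus at `z`. For `p = 0` the lower bound is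
nonpositive and `a = 0` serves. -/
lemma exists_contraction_near_one (p z : Ball n) :
    ∃ a : hardy n, ‖a‖ ≤ 1 ∧ eval p a = 0 ∧
      1 - 2 / (1 - ‖z.1‖) ^ 2 * (1 - ‖p.1‖) ≤ ‖eval z a‖ := by
  have hz1 : ‖z.1‖ < 1 := mem_ball_zero_iff.1 z.2
  have hp1 : ‖p.1‖ < 1 := mem_ball_zero_iff.1 p.2
  rcases eq_or_ne p.1 0 with hp | hp
  · refine ⟨0, norm_zero.trans_le zero_le_one, map_zero _, ?_⟩
    have : 1 ≤ 2 / (1 - ‖z.1‖) ^ 2 := by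
      rw [one_le_div (by nlinarith)]
      nlinarith [norm_nonneg z.1]
    rw [hp, norm_zero, sub_zero, mul_one]
    exact (sub_nonpos.2 this).trans (norm_nonneg _)
  have hp0 : 0 < ‖p.1‖ := norm_pos_iff.2 hp
  let c : Cn n := WithLp.toLp 2 fun j => conj (p.1 j) / ‖p.1‖
  have hc : ‖c‖ ≤ 1 := by
    rw [← sq_le_one_iff₀ (norm_nonneg _), EuclideanSpace.norm_sq_eq]
    have : ∀ j, ‖c j‖ ^ 2 = ‖p.1 j‖ ^ 2 / ‖p.1‖ ^ 2 := fun j => by simp [c, div_pow]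
    simp only [this]
    rw [← Finset.sum_div, ← EuclideanSpace.norm_sq_eq, div_self (by positivity)]
  have hrow : ∀ w : Ball n, eval w (row c) = ⟪p.1, w.1⟫_ℂ / ‖p.1‖ := by
    intro w
    rw [eval_row, PiLp.inner_apply, Finset.sum_div]
    refine Finset.sum_congr rfl fun j _ => ?_
    simp only [c, RCLike.inner_apply]
    ring
  obtain ⟨b, hb, hbL⟩ := exists_blaschke ((norm_row_le c).trans hc) hp0.le hp1
  have hev : ∀ w : Ball n, eval w b * (1 - ‖p.1‖ * eval w (row c)) =
      ‖p.1‖ - eval w (row c) := by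
    intro w
    have h := congrArg (eval w) hbL
    have hs : eval w ((‖p.1‖ : ℂ) • row c) = ‖p.1‖ * eval w (row c) :=
      (eval w).toLinearMap.map_smul _ _
    rw [map_mul, map_sub, map_one, hs, map_sub, AlgHom.commutes] at h
    exact h
  refine ⟨b, hb, ?_, ?_⟩
  · have h := hev p
    rw [hrow, inner_self_eq_norm_sq_to_K] at h
    have hne : (‖p.1‖ : ℂ) ≠ 0 := by exact_mod_cast hp0.ne'
    have h2 : ((‖p.1‖ : ℂ) ^ 2 / ‖p.1‖ : ℂ) = ‖p.1‖ := by field_simp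
    simp only [Complex.coe_algebraMap] at h
    rw [h2, sub_self] at h
    refine (mul_eq_zero.1 h).resolve_right ?_
    have : (1 - ‖p.1‖ * ‖p.1‖ : ℝ) ≠ 0 := by nlinarith
    exact_mod_cast this
  · refine one_sub_le_of_blaschke hp0.le hp1 (t := eval z (row c)) ?_ (by linarith) (hev z)
    rw [hrow, norm_div, Complex.norm_real, norm_norm, sub_sub_cancel, div_le_iff₀ hp0, mul_comm]
    exact norm_inner_le_norm _ _

lemma exists_contraction_ne_zero {p z : Ball n} (h : p ≠ z) :
    ∃ a : hardy n, ‖a‖ ≤ 1 ∧ eval p a = 0 ∧ eval z a ≠ 0 := by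
  let c : Cn n := WithLp.toLp 2 fun j => conj (z.1 j - p.1 j)
  -- Its value at `w` is `⟪z - p, w - p⟫`.
  let a : hardy n := row c - algebraMap ℂ _ (eval p (row c))
  have hp : eval p a = 0 := by
    rw [map_sub, AlgHom.commutes]
    exact sub_self _
  have hz : eval z a ≠ 0 := by
    have hza : eval z a = ((‖z.1 - p.1‖ ^ 2 : ℝ) : ℂ) := by
      rw [map_sub, AlgHom.commutes, EuclideanSpace.norm_sq_eq]
      simp only [eval_row, Algebra.algebraMap_self, RingHom.id_apply]
      rw [← Finset.sum_sub_distrib]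
      push_cast
      refine Finset.sum_congr rfl fun j _ => ?_
      rw [← mul_sub, ← Complex.conj_mul']
      rfl
    have : z.1 - p.1 ≠ 0 := sub_ne_zero.2 fun h' => h (Subtype.ext h'.symm)
    rw [hza]
    exact_mod_cast (pow_pos (norm_pos_iff.2 this) 2).ne'
  have ha : 0 < ‖a‖ := norm_pos_iff.2 fun h' => hz (by rw [h', map_zero])
  have hs : ∀ w : Ball n, eval w (((‖a‖⁻¹ : ℝ) : ℂ) • a) = ((‖a‖⁻¹ : ℝ) : ℂ) * eval w a :=
    fun w => (eval w).toLinearMap.map_smul _ _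
  refine ⟨((‖a‖⁻¹ : ℝ) : ℂ) • a, ?_, ?_, ?_⟩
  · have h : ‖((‖a‖⁻¹ : ℝ) : ℂ) • a‖ ≤ ‖((‖a‖⁻¹ : ℝ) : ℂ)‖ * ‖a‖ := norm_smul_le _ _
    rwa [Complex.norm_real, Real.norm_of_nonneg (by positivity), inv_mul_cancel₀ ha.ne'] at h
  · rw [hs, hp, mul_zero]
  · rw [hs]
    exact mul_ne_zero (by exact_mod_cast (inv_pos.2 ha).ne') hz

/-! ### Infinite products -/

lemma one_sub_sum_le_prod {ι : Type*} (s : Finset ι) {c t : ι → ℝ} (hc : ∀ i ∈ s, 0 ≤ c i)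
    (ht : ∀ i ∈ s, 0 ≤ t i) (h1 : ∀ i ∈ s, t i ≤ 1) (h : ∀ i ∈ s, 1 - c i ≤ t i) :
    1 - ∑ i ∈ s, c i ≤ ∏ i ∈ s, t i := by
  classical
  induction s using Finset.induction_on with
  | empty => simp
  | insert a s ha ih =>
    simp only [Finset.mem_insert, forall_eq_or_imp] at hc ht h1 h
    rw [Finset.sum_insert ha, Finset.prod_insert ha]
    have hi := ih hc.2 ht.2 h1.2 h.2
    have hP0 : 0 ≤ ∏ i ∈ s, t i := Finset.prod_nonneg ht.2
    have hP1 : ∏ i ∈ s, t i ≤ 1 := Finset.prod_le_one ht.2 h1.2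
    nlinarith [hc.1, ht.1, h1.1, h.1, mul_le_mul_of_nonneg_right h.1 hP0]

/-- Outside a finite set `T` the sums of `c` stay below `1/2`, so those factors multiply to at least
`1/2`. Enlarging `s` to `s ∪ T` only lowers the product, as all factors are at most 1. -/
lemma exists_pos_le_prod {ι : Type*} {c t : ι → ℝ} (hc : ∀ i, 0 ≤ c i) (hs : Summable c)
    (ht : ∀ i, 0 < t i) (h1 : ∀ i, t i ≤ 1) (h : ∀ i, c i < 1 → 1 - c i ≤ t i) :
    ∃ δ > 0, ∀ s : Finset ι, δ ≤ ∏ i ∈ s, t i := by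
  classical
  obtain ⟨T, hT⟩ := summable_iff_vanishing_norm.1 hs (1 / 2) (by norm_num)
  refine ⟨(∏ i ∈ T, t i) * (1 / 2), mul_pos (Finset.prod_pos fun i _ => ht i) (by norm_num),
    fun s => ?_⟩
  have hsmall : ∀ i ∈ s \ T, c i < 1 := by
    intro i hi
    have := hT {i} (by simpa using (Finset.mem_sdiff.1 hi).2)
    rw [Finset.sum_singleton, Real.norm_of_nonneg (hc i)] at this
    linarith
  have h2 : 1 / 2 ≤ ∏ i ∈ s \ T, t i := by
    refine le_trans ?_ (one_sub_sum_le_prod _ (fun i _ => hc i) (fun i _ => (ht i).le)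
      (fun i _ => h1 i) fun i hi => h i (hsmall i hi))
    have := (Real.le_norm_self _).trans_lt (hT (s \ T) Finset.sdiff_disjoint)
    linarith
  calc (∏ i ∈ T, t i) * (1 / 2) ≤ (∏ i ∈ T, t i) * ∏ i ∈ s \ T, t i := by
        gcongr
        exact Finset.prod_nonneg fun i _ => (ht i).le
    _ = ∏ i ∈ s ∪ T, t i := by
        rw [mul_comm, ← Finset.prod_union Finset.sdiff_disjoint, Finset.sdiff_union_self_eq_union]
    _ = (∏ i ∈ T \ s, t i) * ∏ i ∈ s, t i := by
        rw [← Finset.prod_union Finset.sdiff_disjoint, Finset.sdiff_union_self_eq_union,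
          Finset.union_comm]
    _ ≤ _ := mul_le_of_le_one_left (Finset.prod_nonneg fun i _ => (ht i).le)
        (Finset.prod_le_one (fun i _ => (ht i).le) fun i _ => h1 i)

/-- The unit ball of the Hardy algebra is compact in the weak operator topology. -/
lemma exists_wot_limit {α : Type*} (U : Ultrafilter α) (φ : α → hardy n) (hφ : ∀ a, ‖φ a‖ ≤ 1) :
    ∃ ψ : hardy n, ∀ x y, Tendsto (fun a => ⟪y, (φ a).1 x⟫_ℂ) U (𝓝 ⟪y, ψ.1 x⟫_ℂ) := by
  have hb : ∀ a x y, ‖⟪y, (φ a).1 x⟫_ℂ‖ ≤ ‖y‖ * ‖x‖ := fun a x y =>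
    (norm_inner_apply_le (φ a) x y).trans (mul_le_of_le_one_right (by positivity) (hφ a))
  have hlim : ∀ y x, ∃ l, Tendsto (fun a => ⟪y, (φ a).1 x⟫_ℂ) U (𝓝 l) := by
    intro y x
    obtain ⟨l, -, hl⟩ := (isCompact_closedBall (0 : ℂ) (‖y‖ * ‖x‖)).ultrafilter_le_nhds'
      (U.map fun a => ⟪y, (φ a).1 x⟫_ℂ) 
      (mem_map.2 (Eventually.of_forall fun a => mem_closedBall_zero_iff.2 (hb a x y)))
    exact ⟨l, hl⟩
  choose B hB using hlim
  let B' : Fock n →ₗ⋆[ℂ] Fock n →ₗ[ℂ] ℂ := LinearMap.mk₂'ₛₗ (starRingEnd ℂ) (RingHom.id ℂ) B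
    (fun y y' x => tendsto_nhds_unique (hB _ _)
      (by simpa only [inner_add_left] using (hB y x).add (hB y' x)))
    (fun c y x => tendsto_nhds_unique (hB _ _)
      (by simpa only [inner_smul_left, smul_eq_mul] using (hB y x).const_mul (conj c)))
    (fun y x x' => tendsto_nhds_unique (hB _ _)
      (by simpa only [map_add, inner_add_right] using (hB y x).add (hB y x')))
    (fun c y x => tendsto_nhds_unique (hB _ _)
      (by simpa only [map_smul, inner_smul_right, smul_eq_mul, RingHom.id_apply] using (hB y x).const_mul c))
  let B'' : Fock n →L⋆[ℂ] Fock n →L[ℂ] ℂ := B'.mkContinuous₂ 1 fun y x => by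
    rw [one_mul]
    exact le_of_tendsto' (hB y x).norm fun a => hb a x y
  -- The Riesz operator of the limit form acts in the first slot of the inner product; the adjoint
  -- moves it to the second.
  let T := (InnerProductSpace.continuousLinearMapOfBilin B'').adjoint
  have hT : ∀ x y, Tendsto (fun a => ⟪y, (φ a).1 x⟫_ℂ) U (𝓝 ⟪y, T x⟫_ℂ) := by
    intro x y
    rw [ContinuousLinearMap.adjoint_inner_right,
      InnerProductSpace.continuousLinearMapOfBilin_apply]
    exact hB y x
  exact ⟨⟨T, mem_hardy_of_tendsto hT⟩, hT⟩

lemma exists_finite_product {ι : Type*} {p : ι → Ball n} {z : Ball n} {a : ι → hardy n}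
    (ha : ∀ i, ‖a i‖ ≤ 1) (hp : ∀ i, eval (p i) (a i) = 0) (s : Finset ι) :
    ∃ φ : hardy n, ‖φ‖ ≤ 1 ∧ (∀ i ∈ s, eval (p i) φ = 0) ∧
      ‖eval z φ‖ = ∏ i ∈ s, ‖eval z (a i)‖ := by
  classical
  induction s using Finset.induction_on with
  | empty =>
    refine ⟨1, ContinuousLinearMap.opNorm_le_bound _ zero_le_one fun x => ?_, by simp, ?_⟩
    · rw [one_mul]
      exact le_rfl
    · rw [map_one, norm_one, Finset.prod_empty]
  | insert i s hi ih =>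
    obtain ⟨φ, h1, h2, h3⟩ := ih
    refine ⟨a i * φ, (norm_mul_le _ _).trans (mul_le_one₀ (ha i) (norm_nonneg _) h1), ?_, ?_⟩
    · intro j hj
      rw [map_mul]
      rcases Finset.mem_insert.1 hj with rfl | hj
      · rw [hp, zero_mul]
      · rw [h2 j hj, mul_zero]
    · rw [map_mul, norm_mul, h3, Finset.prod_insert hi]

/-- Under the Blaschke condition, some element of the Hardy algebra vanishes on the whole family
but not at a given point outside it. -/
theorem exists_mem_nevanlinna_eval_ne_zero {ι : Type*} (p : ι → Ball n)
    (hsum : Summable fun i => 1 - ‖(p i).1‖) {z : Ball n} (hz : z ∉ Set.range p) :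
    ∃ φ ∈ nevanlinna (Set.range p), eval z φ ≠ 0 := by
  set c : ι → ℝ := fun i => 2 / (1 - ‖z.1‖) ^ 2 * (1 - ‖(p i).1‖)
  have hc0 : ∀ i, 0 ≤ c i := fun i =>
    mul_nonneg (by positivity) (by linarith [mem_ball_zero_iff.1 (p i).2])
  have hex : ∀ i, ∃ a : hardy n, ‖a‖ ≤ 1 ∧ eval (p i) a = 0 ∧ eval z a ≠ 0 ∧
      (c i < 1 → 1 - c i ≤ ‖eval z a‖) := by
    intro i
    -- The Möbius bound says nothing when `c i ≥ 1`; there any contraction separating `p i` from `z`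
    -- will do.
    by_cases h : c i < 1
    · obtain ⟨a, h1, h2, h3⟩ := exists_contraction_near_one (p i) z
      exact ⟨a, h1, h2, norm_pos_iff.1 (lt_of_lt_of_le (by linarith) h3), fun _ => h3⟩
    · obtain ⟨a, h1, h2, h3⟩ := exists_contraction_ne_zero (p := p i) (z := z)
        fun h' => hz ⟨i, h'⟩
      exact ⟨a, h1, h2, h3, fun h' => absurd h' h⟩
  choose a ha hpa hza hca using hex
  obtain ⟨δ, hδ, hprod⟩ := exists_pos_le_prod hc0 (hsum.mul_left _)
    (t := fun i => ‖eval z (a i)‖) (fun i => norm_pos_iff.2 (hza i))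
    (fun i => (norm_eval_le z _).trans (ha i)) hca
  choose φ hφ hpφ hzφ using exists_finite_product (z := z) ha hpa
  -- The finite products are chosen independently, so no convergence is claimed; an ultrafilter
  -- finer than `atTop` supplies a limit, and evaluations pass to it as matrix coefficients.
  let U : Ultrafilter (Finset ι) := Ultrafilter.of atTop
  obtain ⟨ψ, hψ⟩ := exists_wot_limit U φ hφ
  have hev : ∀ w : Ball n, Tendsto (fun s => eval w (φ s)) U (𝓝 (eval w ψ)) :=
    fun w => hψ (basisVec []) (kernelVec w)
  refine ⟨ψ, ?_, ?_⟩
  · rintro _ ⟨i, rfl⟩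
    have h0 : ∀ᶠ s in (U : Filter (Finset ι)), eval (p i) (φ s) = 0 :=
      Ultrafilter.of_le _ ((eventually_ge_atTop {i}).mono fun s hs =>
        hpφ s i (hs (Finset.mem_singleton_self i)))
    exact tendsto_nhds_unique (hev (p i)) (tendsto_const_nhds.congr' (h0.mono fun _ h => h.symm))
  · refine norm_pos_iff.1 (hδ.trans_le (ge_of_tendsto' (hev z).norm fun s => ?_))
    rw [hzφ]
    exact hprod s

/-! ### The spectrum of the quotient -/

/-- The evaluation at a point of `Δ` as a character of `Fₙ^∞ / 𝒩_Δ`. -/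
noncomputable def evalQuotient {Δ : Set (Ball n)} (z : Δ) : (hardy n ⧸ nevanlinna Δ) →ₐ[ℂ] ℂ :=
  Ideal.Quotient.liftₐ (nevanlinna Δ) (eval z.1) fun _ hφ => hφ z.1 z.2

lemma evalQuotient_mk {Δ : Set (Ball n)} (z : Δ) (φ : hardy n) :
    evalQuotient z (Ideal.Quotient.mk (nevanlinna Δ) φ) = eval z.1 φ := rfl

lemma continuous_evalQuotient {Δ : Set (Ball n)} (z : Δ) :
    @Continuous _ _ (weakStar (nevanlinna Δ)) inferInstance (evalQuotient z) := by
  refine (continuous_weakStar_iff _ (evalQuotient z).toLinearMap).2 ?_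
  have h : (evalQuotient z).toLinearMap ∘ₗ (Ideal.Quotient.mkₐ ℂ (nevanlinna Δ)).toLinearMap =
      (eval z.1).toLinearMap := LinearMap.ext fun φ => evalQuotient_mk z φ
  rw [h]
  exact eval_mem_predual z.1

/-- The element of the spectrum of `Fₙ^∞ / 𝒩_Δ` given by evaluation at a point of `Δ`. -/
noncomputable def evalSpec {Δ : Set (Ball n)} (z : Δ) : Spec (nevanlinna Δ) :=
  ⟨evalQuotient z, continuous_evalQuotient z⟩

lemma evalSpec_mk {Δ : Set (Ball n)} (z : Δ) (φ : hardy n) :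
    (evalSpec z).1 (Ideal.Quotient.mk (nevanlinna Δ) φ) = eval z.1 φ := rfl

lemma evalSpec_injective {Δ : Set (Ball n)} :
    Function.Injective (evalSpec : Δ → Spec (nevanlinna Δ)) := by
  intro z w h
  refine Subtype.ext (Subtype.ext (PiLp.ext fun j => ?_))
  rw [← eval_gen, ← eval_gen, ← evalSpec_mk, h, evalSpec_mk]

lemma exists_ball_of_spec {Δ : Set (Ball n)} (π : Spec (nevanlinna Δ)) :
    ∃ z : Ball n, ∀ φ, π.1 (Ideal.Quotient.mk (nevanlinna Δ) φ) = eval z φ := by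
  have h : (π.1.comp (Ideal.Quotient.mkₐ ℂ (nevanlinna Δ))).toLinearMap ∈ predual n :=
    (continuous_weakStar_iff _ π.1.toLinearMap).1 π.2
  obtain ⟨z, hz⟩ := exists_eq_eval_of_mem_predual h
  exact ⟨z, fun φ => DFunLike.congr_fun hz φ⟩

lemma continuous_spec_apply {J : Ideal (hardy n)} [J.IsTwoSided] (a : hardy n ⧸ J) :
    Continuous fun π : Spec J => π.1 a :=
  (continuous_apply a).comp continuous_induced_dom

lemma evalSpec_surjective {ι : Type*} {p : ι → Ball n}
    (hp : Summable fun i => 1 - ‖(p i).1‖) :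
    Function.Surjective (evalSpec : Set.range p → Spec (nevanlinna (Set.range p))) := by
  intro π
  obtain ⟨z, hz⟩ := exists_ball_of_spec π
  -- Off the family, an element of the ideal nonzero at `z` would have class 0 but nonzero image.
  have hmem : z ∈ Set.range p := by
    by_contra hz'
    obtain ⟨φ, hφ, hne⟩ := exists_mem_nevanlinna_eval_ne_zero p hp hz'
    apply hne
    rw [← hz, Ideal.Quotient.eq_zero_iff_mem.2 hφ]
    exact map_zero π.1
  refine ⟨⟨z, hmem⟩, Subtype.ext (AlgHom.ext fun a => ?_)⟩
  obtain ⟨φ, rfl⟩ := Ideal.Quotient.mk_surjective a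
  rw [evalSpec_mk, hz]

lemma discreteTopology_range {ι : Type*} {p : ι → Ball n}
    (hp : Summable fun i => 1 - ‖(p i).1‖) : DiscreteTopology (Set.range p) := by
  refine discreteTopology_iff_isOpen_singleton.2 fun z => ?_
  have hz : ‖z.1.1‖ < 1 := mem_ball_zero_iff.1 z.1.2
  obtain ⟨r, hzr, hr⟩ := exists_between hz
  have hopen : IsOpen {w : Set.range p | ‖w.1.1‖ < r} := isOpen_lt (by fun_prop) (by fun_prop)
  refine isOpen_singleton_of_finite_mem_nhds z (hopen.mem_nhds hzr) ?_
  -- The terms of a convergent series exceed `1 - r` only finitely often.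
  have hfin : {i | ‖(p i).1‖ < r}.Finite := by
    have h := hp.tendsto_cofinite_zero.eventually_le_const (show 0 < 1 - r by linarith)
    refine (Filter.eventually_cofinite.1 h).subset fun i hi => ?_
    simp only [Set.mem_ofPred_eq] at hi ⊢
    linarith
  refine (hfin.image (Set.rangeFactorization p)).subset ?_
  rintro ⟨_, i, rfl⟩ hi
  exact ⟨i, hi, rfl⟩

/-- Under the Blaschke condition the spectrum of `Fₙ^∞ / 𝒩_Δ` is homeomorphic to `Δ`. -/
noncomputable def evalHomeomorph {ι : Type*} {p : ι → Ball n}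
    (hp : Summable fun i => 1 - ‖(p i).1‖) :
    Set.range p ≃ₜ Spec (nevanlinna (Set.range p)) where
  toEquiv := Equiv.ofBijective evalSpec ⟨evalSpec_injective, evalSpec_surjective hp⟩
  continuous_toFun :=
    haveI := discreteTopology_range hp
    continuous_of_discreteTopology
  continuous_invFun := by
    set e := Equiv.ofBijective (evalSpec (Δ := Set.range p))
      ⟨evalSpec_injective, evalSpec_surjective hp⟩
    -- The topology of `Δ` comes from `Cn n`, where the inverse is `π ↦ (π(S_j))`, continuous for
    -- pointwise convergence.
    refine continuous_induced_rng.2 (continuous_induced_rng.2 ?_)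
    have h : ∀ π, (e.symm π).1.1 = WithLp.toLp 2 fun j =>
        π.1 (Ideal.Quotient.mk (nevanlinna (Set.range p)) (gen j)) := by
      intro π
      refine PiLp.ext fun j => ?_
      conv_rhs => rw [← e.apply_symm_apply π]
      exact (eval_gen _ j).symm
    refine Continuous.congr ?_ fun π => (h π).symm
    exact (PiLp.continuous_toLp 2 _).comp (continuous_pi fun j => continuous_spec_apply _)

end NCHardy

theorem mainTheorem3 (n : ℕ) (hn : 0 < n) {ι : Type*} (lam : ι → NCHardy.Ball n)
    (hlam : Summable fun i => 1 - ‖(lam i : NCHardy.Cn n)‖) :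
    (∃ h : Set.range lam ≃ₜ NCHardy.Spec (NCHardy.nevanlinna (Set.range lam)),
      ∀ (z : Set.range lam) (φ : NCHardy.hardy n),
        (h z).1 (Ideal.Quotient.mk (NCHardy.nevanlinna (Set.range lam)) φ) =
          NCHardy.eval z.1 φ) ∧
    NCHardy.spectralClosure (Set.range lam) = Subtype.val '' Set.range lam := by
  refine ⟨⟨NCHardy.evalHomeomorph hlam, NCHardy.evalSpec_mk⟩, Set.ext fun w => ⟨?_, ?_⟩⟩
  · rintro ⟨π, hπ⟩
    obtain ⟨z, rfl⟩ := NCHardy.evalSpec_surjective hlam π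
    refine ⟨z.1, z.2, PiLp.ext fun j => ?_⟩
    rw [← hπ, NCHardy.evalSpec_mk, NCHardy.eval_gen]
  · rintro ⟨z, hz, rfl⟩
    exact ⟨NCHardy.evalSpec ⟨z, hz⟩, fun j => by rw [NCHardy.evalSpec_mk, NCHardy.eval_gen]⟩
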